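/- A Lorentzian matrix is a real symmetric matrix with nonnegative entries that has at most one positive eigenvalue, counted with multiplicity. Let $\mathbb{L}_n$ be the set of $n\times n$ Lorentzian matrices and $\mathbb{L}_n^+\subseteq\mathbb{L}_n$ the subset of those with only positive entries. For a real vector $\alpha=(\alpha_{ij})_{1\le i\le j\le n}$ and $p\in\mathbb{L}_n^+$ write $p^\alpha=\prod_{1\le i\le j\le n}p_{ij}^{\alpha_{ij}}$. Let $\mathrm{BR}(\mathbb{L}_n^+)$ be the set of all $\alpha\in\mathbb{R}^{\binom{n+1}{2}}$ for which there is a constant $c>0$ with $p^\alpha\le c$ for all $p\in\mathbb{L}_n^+$; the infimum of all such constants $c$ is the optimal bounding constant of $\alpha$ on $\mathbb{L}_n^+$. Let $\mathbf{e}_{ij}=\mathbf{e}_{ji}$ be the standard basis vectors of $\mathbb{R}^{\binom{n+1}{2}}$ and, for $1\le i,j,k,l,m\le n$, define the pentagonal ratio \[ \alpha^{ijk|lm}=\mathbf{e}_{ij}+\mathbf{e}_{ik}+\mathbf{e}_{jk}+\mathbf{e}_{ll}+\mathbf{e}_{lm}+\mathbf{e}_{mm}-\mathbf{e}_{il}-\mathbf{e}_{jl}-\mathbf{e}_{kl}-\mathbf{e}_{im}-\mathbf{e}_{jm}-\mathbf{e}_{km}.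 \] Theorem A. (1) For every $n$, every $(p_{ij})\in\mathbb{L}_n$, and all indices $i,j,k,l,m\in\{1,\dots,n\}$, not necessarily distinct, \[ p_{ij}\,p_{ik}\,p_{jk}\,p_{ll}\,p_{lm}\,p_{mm}\le 4\,p_{il}\,p_{jl}\,p_{kl}\,p_{im}\,p_{jm}\,p_{km}. \] (2) For every $n$ and all distinct $i,j,k,l,m\in\{1,\dots,n\}$ the constant $4$ is optimal: it cannot be replaced by a smaller constant in the inequality for all matrices in $\mathbb{L}_n$, and $\alpha^{ijk|lm}$ is a bounded ratio on $\mathbb{L}_n^+$ with optimal bounding constant $4$. (3) $\mathrm{BR}(\mathbb{L}_5^+)$ is the convex cone generated by the pentagonal ratios, that is, the set of all finite nonnegative real linear combinations of the vectors $\alpha^{ijk|lm}$ with $1\le i,j,k,l,m\le 5$, where the indices may coincide. -/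

import Mathlib

noncomputable section

/-- A Lorentzian matrix: a real symmetric matrix with nonnegative entries that has at most one
positive eigenvalue. For a real matrix `Matrix.IsHermitian` says that it is symmetric, and
`Matrix.IsHermitian.eigenvalues` lists the eigenvalues with multiplicity. -/
structure IsLorentzian {n : ℕ} (p : Matrix (Fin n) (Fin n) ℝ) : Prop where
  isHermitian : p.IsHermitian
  nonneg : ∀ i j, 0 ≤ p i j
  card_pos_eigenvalues_le_one :
    (Finset.univ.filter fun i => 0 < isHermitian.eigenvalues i).card ≤ 1

/-- The set of `n × n` Lorentzian matrices. -/
def lorentzian (n : ℕ) : Set (Matrix (Fin n) (Fin n) ℝ) :=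
  {p | IsLorentzian p}

/-- The set of `n × n` Lorentzian matrices with only positive entries. -/
def lorentzianPos (n : ℕ) : Set (Matrix (Fin n) (Fin n) ℝ) :=
  {p | IsLorentzian p ∧ ∀ i j, 0 < p i j}

/-- The index set of the upper triangular entries: pairs `(i, j)` with `i ≤ j`. -/
abbrev UpperPair (n : ℕ) : Type :=
  {q : Fin n × Fin n // q.1 ≤ q.2}

/-- The standard basis vector indexed by the unordered pair `{i, j}`, so that
`basisVec i j = basisVec j i`. -/
def basisVec {n : ℕ} (i j : Fin n) : UpperPair n → ℝ :=
  Pi.single ⟨(min i j, max i j), min_le_max⟩ 1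

/-- The monomial `∏_{i ≤ j} p_{ij} ^ α_{ij}` with real exponents. It is used only for matrices
with positive entries. -/
def ratioMonomial {n : ℕ} (α : UpperPair n → ℝ) (p : Matrix (Fin n) (Fin n) ℝ) : ℝ :=
  ∏ q : UpperPair n, p q.1.1 q.1.2 ^ α q

/-- The set of bounded ratios on a set `X` of symmetric matrices with positive entries. -/
def boundedRatios {n : ℕ} (X : Set (Matrix (Fin n) (Fin n) ℝ)) : Set (UpperPair n → ℝ) :=
  {α | ∃ c : ℝ, 0 < c ∧ ∀ p ∈ X, ratioMonomial α p ≤ c}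

/-- The optimal bounding constant of `α` on `X`: the infimum of all positive constants that
bound the monomial of `α` on `X`. -/
def optimalBoundingConstant {n : ℕ} (X : Set (Matrix (Fin n) (Fin n) ℝ))
    (α : UpperPair n → ℝ) : ℝ :=
  sInf {c : ℝ | 0 < c ∧ ∀ p ∈ X, ratioMonomial α p ≤ c}

/-- The pentagonal ratio `α^{ijk|lm}`. -/
def pentagonalRatio {n : ℕ} (i j k l m : Fin n) : UpperPair n → ℝ :=
  basisVec i j + basisVec i k + basisVec j k + basisVec l l + basisVec l m + basisVec m m
    - basisVec i l - basisVec j l - basisVec k l - basisVec i m - basisVec j m - basisVec k m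

end

/-! A Lorentzian form is nonpositive on a hyperplane, so reverse Cauchy-Schwarz holds. Normalize `l`
and `m` and put `t = B l m`. If `t > 1` they span a Lorentzian plane whose orthogonal complement is
nonpositive, so in null coordinates `x`, `y` of that plane a multiple of `B u u` is at most `2xy`.
The difference is a positive semidefinite form; replacing it on the three vectors by a Gram matrix
of planar vectors bounds their pairwise products by squared moduli of the minors of three pairs of
complex numbers. The product of these minors is a Vandermonde determinant, and Hadamard's inequality
with weight `2t` gives the constant 4 (`triple_product_le`, `pentagonal_inequality_of_normalized`).
Collinear points of the hyperbolic plane, spread apart, show that 4 is optimal.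

For the cone with `n = 5`, let `f` be a functional that is nonpositive on the pentagonal ratios. Up
to a term `g a + g b` it is a semimetric on five points satisfying the pentagonal inequalities. Such
a semimetric is a nonnegative combination of cuts (`IsPentagonalMetric.mem_hull_cutMetric`). Rays
along cuts and along `±(g a + g b)` exponentiate to Lorentzian matrices, so `f` is nonpositive on
every bounded ratio, and Farkas' lemma concludes. -/

/-! ### Hadamard's inequality and the triple product bound. -/

/-- Hadamard's inequality for complex `3 × 3` matrices, in expanded form. -/
theorem normSq_det_three_le (a b c : Fin 3 → ℂ) :
    Complex.normSq (a 0 * (b 1 * c 2 - b 2 * c 1) + a 1 * (b 2 * c 0 - b 0 * c 2)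
        + a 2 * (b 0 * c 1 - b 1 * c 0)) ≤
      (∑ i, Complex.normSq (a i)) * (∑ i, Complex.normSq (b i)) * ∑ i, Complex.normSq (c i) := by
  have cauchy : ∀ u v : Fin 3 → ℂ, Complex.normSq (u 0 * v 0 + u 1 * v 1 + u 2 * v 2) ≤
      (∑ i, Complex.normSq (u i)) * ∑ i, Complex.normSq (v i) := by
    intro u v
    -- Lagrange's identity; the identity for `cross` below is its companion for the cross product.
    have h : (∑ i, Complex.normSq (u i)) * (∑ i, Complex.normSq (v i)) =
        Complex.normSq (u 0 * v 0 + u 1 * v 1 + u 2 * v 2)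
        + Complex.normSq (u 0 * star (v 1) - u 1 * star (v 0))
        + Complex.normSq (u 0 * star (v 2) - u 2 * star (v 0))
        + Complex.normSq (u 1 * star (v 2) - u 2 * star (v 1)) := by
      simp [Fin.sum_univ_three, Complex.normSq_apply]
      ring
    rw [h]
    linarith [Complex.normSq_nonneg (u 0 * star (v 1) - u 1 * star (v 0)),
      Complex.normSq_nonneg (u 0 * star (v 2) - u 2 * star (v 0)),
      Complex.normSq_nonneg (u 1 * star (v 2) - u 2 * star (v 1))]
  have cross : Complex.normSq (b 1 * c 2 - b 2 * c 1) + Complex.normSq (b 2 * c 0 - b 0 * c 2)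
      + Complex.normSq (b 0 * c 1 - b 1 * c 0) ≤
      (∑ i, Complex.normSq (b i)) * ∑ i, Complex.normSq (c i) := by
    have h : (∑ i, Complex.normSq (b i)) * (∑ i, Complex.normSq (c i)) =
        Complex.normSq (b 1 * c 2 - b 2 * c 1) + Complex.normSq (b 2 * c 0 - b 0 * c 2)
        + Complex.normSq (b 0 * c 1 - b 1 * c 0)
        + Complex.normSq (b 0 * star (c 0) + b 1 * star (c 1) + b 2 * star (c 2)) := by
      simp [Fin.sum_univ_three, Complex.normSq_apply]
      ring
    rw [h]
    linarith [Complex.normSq_nonneg (b 0 * star (c 0) + b 1 * star (c 1) + b 2 * star (c 2))]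
  refine (cauchy a ![b 1 * c 2 - b 2 * c 1, b 2 * c 0 - b 0 * c 2, b 0 * c 1 - b 1 * c 0]).trans ?_
  rw [mul_assoc]
  refine mul_le_mul_of_nonneg_left ?_ (Finset.sum_nonneg fun i _ => Complex.normSq_nonneg _)
  simpa [Fin.sum_univ_three] using cross

/-- Hadamard's inequality for the weighted homogeneous Vandermonde matrix. -/
theorem weighted_vandermonde_le {κ : ℝ} (hκ : 0 ≤ κ) (a b : Fin 3 → ℂ) :
    κ * (Complex.normSq (a 0 * b 1 - a 1 * b 0) * Complex.normSq (a 0 * b 2 - a 2 * b 0)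
        * Complex.normSq (a 1 * b 2 - a 2 * b 1)) ≤
      ∏ i, (Complex.normSq (a i) ^ 2 + κ * (Complex.normSq (a i) * Complex.normSq (b i))
        + Complex.normSq (b i) ^ 2) := by
  have hs : Complex.normSq (Real.sqrt κ : ℂ) = κ := by
    rw [Complex.normSq_ofReal, Real.mul_self_sqrt hκ]
  -- The determinant of these vectors is, up to sign, `√κ` times the product of the three minors.
  have key := normSq_det_three_le (fun i => ![b 0 ^ 2, Real.sqrt κ * (a 0 * b 0), a 0 ^ 2] i)
    (fun i => ![b 1 ^ 2, Real.sqrt κ * (a 1 * b 1), a 1 ^ 2] i)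
    (fun i => ![b 2 ^ 2, Real.sqrt κ * (a 2 * b 2), a 2 ^ 2] i)
  simp only [Fin.sum_univ_three, Matrix.cons_val_zero, Matrix.cons_val_one, Matrix.cons_val,
    map_mul, map_pow, hs] at key
  rw [Fin.prod_univ_three]
  calc _ = Complex.normSq (Real.sqrt κ * ((a 0 * b 1 - a 1 * b 0) * (a 0 * b 2 - a 2 * b 0)
        * (a 1 * b 2 - a 2 * b 1))) := by simp only [map_mul, hs]
    _ = _ := by rw [← Complex.normSq_neg]; congr 1; ring
    _ ≤ _ := key
    _ = _ := by ring

/-- A positive semidefinite form in three variables is bounded below, in the off-diagonal entry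
`n12`, by the Gram form of three coplanar vectors with the same norms. -/
theorem exists_coplanar_angles {g1 g2 g3 n12 n13 n23 : ℝ} (h1 : 0 ≤ g1) (h2 : 0 ≤ g2)
    (h3 : 0 ≤ g3)
    (h : ∀ a b c : ℝ, 0 ≤ g1 ^ 2 * a ^ 2 + g2 ^ 2 * b ^ 2 + g3 ^ 2 * c ^ 2
      + 2 * n12 * a * b + 2 * n13 * a * c + 2 * n23 * b * c) :
    ∃ c1 s1 c2 s2 : ℝ, c1 ^ 2 + s1 ^ 2 = 1 ∧ c2 ^ 2 + s2 ^ 2 = 1 ∧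
      n13 = g1 * g3 * c1 ∧ n23 = g2 * g3 * c2 ∧ g1 * g2 * (c1 * c2 - s1 * s2) ≤ n12 := by
  have aux : ∀ {g g' n : ℝ}, (∀ a b : ℝ, 0 ≤ g ^ 2 * a ^ 2 + g' ^ 2 * b ^ 2 + 2 * n * a * b) →
      n ^ 2 ≤ (g * g') ^ 2 := by
    intro g g' n hn
    have := discrim_le_zero (a := g ^ 2) (b := 2 * n) (c := g' ^ 2)
      (fun x => by have := hn x 1; nlinarith)
    unfold discrim at this
    nlinarith
  have q12 : n12 ^ 2 ≤ (g1 * g2) ^ 2 := aux fun a b => by have := h a b 0; nlinarith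
  have q13 : n13 ^ 2 ≤ (g1 * g3) ^ 2 := aux fun a b => by have := h a 0 b; nlinarith
  have q23 : n23 ^ 2 ≤ (g2 * g3) ^ 2 := aux fun a b => by have := h 0 a b; nlinarith
  -- For `g = 0` the angle is set to a right angle, so that if `g3 = 0` the two angles add up to `π`
  -- and the claim is just `-(g1 * g2) ≤ n12`.
  have exc : ∀ {g n : ℝ}, n ^ 2 ≤ g ^ 2 → ∃ c s : ℝ, 0 ≤ s ∧ c ^ 2 + s ^ 2 = 1 ∧ n = g * c ∧
      (g = 0 → c = 0) := by
    intro g n hn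
    rcases eq_or_ne g 0 with rfl | hg
    · exact ⟨0, 1, by norm_num, by norm_num, by nlinarith, fun _ => rfl⟩
    · have hc : (n / g) ^ 2 ≤ 1 := by
        rw [div_pow]; exact (div_le_one (by positivity)).2 hn
      refine ⟨n / g, Real.sqrt (1 - (n / g) ^ 2), Real.sqrt_nonneg _, ?_, by field_simp,
        fun h => absurd h hg⟩
      rw [Real.sq_sqrt (by linarith)]; ring
  obtain ⟨c1, s1, hs1, e1, f1, z1⟩ := exc q13
  obtain ⟨c2, s2, hs2, e2, f2, z2⟩ := exc q23
  refine ⟨c1, s1, c2, s2, e1, e2, f1, f2, ?_⟩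
  rcases h1.eq_or_lt with rfl | p1
  · nlinarith
  rcases h2.eq_or_lt with rfl | p2
  · nlinarith
  rcases h3.eq_or_lt with rfl | p3
  · have hc1 := z1 (by ring)
    have hc2 := z2 (by ring)
    subst hc1 hc2
    have hs1' : s1 = 1 := by nlinarith
    have hs2' : s2 = 1 := by nlinarith
    subst hs1' hs2'
    have := abs_le_of_sq_le_sq' q12 (by positivity)
    linarith [this.1]
  set e := n12 / (g1 * g2) with he
  have fe : n12 = g1 * g2 * e := by rw [he]; field_simp
  rw [fe]
  refine mul_le_mul_of_nonneg_left ?_ (by positivity)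
  have hq : ∀ a b : ℝ, 0 ≤ s1 ^ 2 * a ^ 2 + s2 ^ 2 * b ^ 2 + 2 * (e - c1 * c2) * a * b := by
    intro a b
    -- The third coefficient minimizes the form, which leaves the Schur complement.
    have := h (a / g1) (b / g2) (-(c1 * a + c2 * b) / g3)
    rw [f1, f2, fe] at this
    have e3 : g1 ^ 2 * (a / g1) ^ 2 + g2 ^ 2 * (b / g2) ^ 2
        + g3 ^ 2 * (-(c1 * a + c2 * b) / g3) ^ 2 + 2 * (g1 * g2 * e) * (a / g1) * (b / g2)
        + 2 * (g1 * g3 * c1) * (a / g1) * (-(c1 * a + c2 * b) / g3)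
        + 2 * (g2 * g3 * c2) * (b / g2) * (-(c1 * a + c2 * b) / g3) =
        a ^ 2 + b ^ 2 + (c1 * a + c2 * b) ^ 2 + 2 * e * a * b
        - 2 * c1 * a * (c1 * a + c2 * b) - 2 * c2 * b * (c1 * a + c2 * b) := by
      field_simp
      ring
    rw [e3] at this
    have t1 : s1 ^ 2 = 1 - c1 ^ 2 := by linarith
    have t2 : s2 ^ 2 = 1 - c2 ^ 2 := by linarith
    rw [t1, t2]
    nlinarith
  have := abs_le_of_sq_le_sq' (aux hq) (by positivity)
  linarith [this.1]

/-- The inequality behind the pentagonal ratio in null coordinates of a Lorentzian plane. -/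
theorem triple_product_le {x y : Fin 3 → ℝ} {κ p11 p22 p33 p12 p13 p23 : ℝ} (hκ : 0 ≤ κ)
    (hx : ∀ i, 0 ≤ x i) (hy : ∀ i, 0 ≤ y i) (h11 : 0 ≤ p11) (h22 : 0 ≤ p22) (h33 : 0 ≤ p33)
    (h13 : 0 ≤ p13) (h23 : 0 ≤ p23)
    (h : ∀ a b c : ℝ, p11 * a ^ 2 + p22 * b ^ 2 + p33 * c ^ 2
      + 2 * p12 * a * b + 2 * p13 * a * c + 2 * p23 * b * c ≤
      2 * (x 0 * a + x 1 * b + x 2 * c) * (y 0 * a + y 1 * b + y 2 * c)) :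
    κ * (p12 * p13 * p23) ≤ ∏ i, (x i ^ 2 + κ * (x i * y i) + y i ^ 2) := by
  set r : Fin 3 → ℝ := fun i => Real.sqrt (x i) with hr
  set s : Fin 3 → ℝ := fun i => Real.sqrt (y i) with hs
  have hr0 : ∀ i, 0 ≤ r i := fun i => Real.sqrt_nonneg _
  have hs0 : ∀ i, 0 ≤ s i := fun i => Real.sqrt_nonneg _
  have hr2 : ∀ i, x i = r i ^ 2 := fun i => (Real.sq_sqrt (hx i)).symm
  have hs2 : ∀ i, y i = s i ^ 2 := fun i => (Real.sq_sqrt (hy i)).symm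
  -- Dropping the nonnegative `pii` from `h` leaves a semidefinite form with diagonal `x i * y i`,
  -- the square of `r i * s i`.
  obtain ⟨c1, s1, c2, s2, e1, e2, f13, f23, f12⟩ := exists_coplanar_angles
    (g1 := r 0 * s 0) (g2 := r 1 * s 1) (g3 := r 2 * s 2)
    (n12 := (x 0 * y 1 + x 1 * y 0 - p12) / 2) (n13 := (x 0 * y 2 + x 2 * y 0 - p13) / 2)
    (n23 := (x 1 * y 2 + x 2 * y 1 - p23) / 2)
    (mul_nonneg (hr0 0) (hs0 0)) (mul_nonneg (hr0 1) (hs0 1)) (mul_nonneg (hr0 2) (hs0 2)) (by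
      intro a b c
      have h1 := h a b c
      have h2 : 0 ≤ p11 * a ^ 2 + p22 * b ^ 2 + p33 * c ^ 2 := by positivity
      simp only [mul_pow, ← hr2, ← hs2]
      nlinarith)
  -- The numbers `r i` receive the arguments `θ1`, `-θ2`, `0`; by the law of cosines the squared
  -- minors are `p13`, `p23` and a bound for `p12`.
  have key := weighted_vandermonde_le hκ ![⟨r 0 * c1, r 0 * s1⟩, ⟨r 1 * c2, -(r 1 * s2)⟩, (r 2 : ℂ)]
    (fun i => (s i : ℂ))
  simp only [Fin.prod_univ_three, Matrix.cons_val_zero, Matrix.cons_val_one, Matrix.cons_val,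
    Complex.normSq_ofReal] at key
  have n0 : Complex.normSq ⟨r 0 * c1, r 0 * s1⟩ = r 0 ^ 2 := by
    simp only [Complex.normSq_mk]; linear_combination r 0 ^ 2 * e1
  have n1 : Complex.normSq ⟨r 1 * c2, -(r 1 * s2)⟩ = r 1 ^ 2 := by
    simp only [Complex.normSq_mk]; linear_combination r 1 ^ 2 * e2
  rw [n0, n1] at key
  have m01 : p12 ≤ Complex.normSq (⟨r 0 * c1, r 0 * s1⟩ * (s 1 : ℂ)
      - ⟨r 1 * c2, -(r 1 * s2)⟩ * (s 0 : ℂ)) := by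
    simp only [Complex.normSq_apply, Complex.sub_re, Complex.sub_im, Complex.mul_re,
      Complex.mul_im, Complex.ofReal_re, Complex.ofReal_im]
    rw [hr2, hr2, hs2, hs2] at f12
    linarith [show (r 0 * c1 * s 1 - r 0 * s1 * 0 - (r 1 * c2 * s 0 - -(r 1 * s2) * 0)) *
        (r 0 * c1 * s 1 - r 0 * s1 * 0 - (r 1 * c2 * s 0 - -(r 1 * s2) * 0)) +
      (r 0 * c1 * 0 + r 0 * s1 * s 1 - (r 1 * c2 * 0 + -(r 1 * s2) * s 0)) *
        (r 0 * c1 * 0 + r 0 * s1 * s 1 - (r 1 * c2 * 0 + -(r 1 * s2) * s 0)) =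
      r 0 ^ 2 * s 1 ^ 2 + r 1 ^ 2 * s 0 ^ 2 - 2 * (r 0 * s 0 * (r 1 * s 1) * (c1 * c2 - s1 * s2))
      by linear_combination r 0 ^ 2 * s 1 ^ 2 * e1 + r 1 ^ 2 * s 0 ^ 2 * e2]
  have m02 : p13 = Complex.normSq (⟨r 0 * c1, r 0 * s1⟩ * (s 2 : ℂ) - (r 2 : ℂ) * (s 0 : ℂ)) := by
    simp only [Complex.normSq_apply, Complex.sub_re, Complex.sub_im, Complex.mul_re,
      Complex.mul_im, Complex.ofReal_re, Complex.ofReal_im]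
    rw [hr2, hr2, hs2, hs2] at f13
    linear_combination -2 * f13 - r 0 ^ 2 * s 2 ^ 2 * e1
  have m12 : p23 = Complex.normSq (⟨r 1 * c2, -(r 1 * s2)⟩ * (s 2 : ℂ)
      - (r 2 : ℂ) * (s 1 : ℂ)) := by
    simp only [Complex.normSq_apply, Complex.sub_re, Complex.sub_im, Complex.mul_re,
      Complex.mul_im, Complex.ofReal_re, Complex.ofReal_im]
    rw [hr2, hr2, hs2, hs2] at f23
    linear_combination -2 * f23 - r 1 ^ 2 * s 2 ^ 2 * e2
  rw [← m02, ← m12] at key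
  rw [Fin.prod_univ_three, hr2, hr2, hr2, hs2, hs2, hs2]
  refine le_trans ?_ (key.trans (le_of_eq (by ring)))
  gcongr

/-! ### The pentagonal inequality in a Lorentzian space. -/

/-- The reverse Cauchy-Schwarz inequality. -/
theorem reverse_cauchy_schwarz {V : Type*} [AddCommGroup V] [Module ℝ V]
    {B : V →ₗ[ℝ] V →ₗ[ℝ] ℝ} (hB : ∀ x y, B x y = B y x) {φ : V →ₗ[ℝ] ℝ}
    (hφ : ∀ x, φ x = 0 → B x x ≤ 0) {l : V} (hl : 0 < B l l) (v : V) :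
    B l l * B v v ≤ B l v ^ 2 := by
  set w := B l l • v - B l v • l with hw
  have hlw : B l w = 0 := by simp [hw]; ring
  have hww : B w w = B l l * (B l l * B v v - B l v ^ 2) := by
    simp [hw, hB v l]; ring
  by_contra! hlt
  have hpos : 0 < B w w := by rw [hww]; exact mul_pos hl (by linarith)
  -- If `B w w > 0`, the form is positive definite on the span of `l` and `w`, which meets the
  -- kernel of `φ`.
  have h1 := hφ (φ w • l - φ l • w) (by simp; ring)
  have h2 : B (φ w • l - φ l • w) (φ w • l - φ l • w) =
      φ w ^ 2 * B l l + φ l ^ 2 * B w w := by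
    have : B w l = 0 := by rw [hB, hlw]
    simp [hlw, this]; ring
  rw [h2] at h1
  have h3 : φ l = 0 := by
    have : φ l ^ 2 * B w w ≤ 0 := by nlinarith [mul_nonneg (sq_nonneg (φ w)) hl.le]
    by_contra hne
    have : 0 < φ l ^ 2 * B w w := by positivity
    linarith
  linarith [hφ l h3]

/-- The pentagonal inequality for vectors in a Lorentzian space when the two distinguished vectors
are normalized. -/
theorem pentagonal_inequality_of_normalized {V : Type*} [AddCommGroup V] [Module ℝ V]
    {B : V →ₗ[ℝ] V →ₗ[ℝ] ℝ} (hB : ∀ x y, B x y = B y x) {φ : V →ₗ[ℝ] ℝ}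
    (hφ : ∀ x, φ x = 0 → B x x ≤ 0) {v : Fin 3 → V} {l m : V} (hl : B l l = 1) (hm : B m m = 1)
    (hlm : 0 ≤ B l m) (hv : ∀ i j, 0 ≤ B (v i) (v j)) (hlv : ∀ i, 0 ≤ B l (v i))
    (hmv : ∀ i, 0 ≤ B m (v i)) :
    B (v 0) (v 1) * B (v 0) (v 2) * B (v 1) (v 2) * B l m ≤
      4 * ∏ i, (B l (v i) * B m (v i)) := by
  set t := B l m with ht
  have hml : B m l = t := hB m l
  have ht1 : 1 ≤ t := by
    have := reverse_cauchy_schwarz hB hφ (l := l) (by rw [hl]; norm_num) m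
    rw [hl, hm, ← ht] at this
    nlinarith
  have comb : ∀ a b c : ℝ, B (a • v 0 + b • v 1 + c • v 2) (a • v 0 + b • v 1 + c • v 2) =
      B (v 0) (v 0) * a ^ 2 + B (v 1) (v 1) * b ^ 2 + B (v 2) (v 2) * c ^ 2
      + 2 * B (v 0) (v 1) * a * b + 2 * B (v 0) (v 2) * a * c + 2 * B (v 1) (v 2) * b * c := by
    intro a b c
    simp [hB (v 1) (v 0), hB (v 2) (v 0), hB (v 2) (v 1)]
    ring
  -- For `t = 1` the vector `l - m` is null and orthogonal to `l`. Adding multiples of it to `u`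
  -- would violate reverse Cauchy-Schwarz unless it is orthogonal to `u`; the chosen `s` exceeds the
  -- bound by 1.
  rcases ht1.eq_or_lt with h1 | h1
  · have hab : ∀ u, B l u = B m u := by
      intro u
      by_contra hne
      have hne' : B l u - B m u ≠ 0 := sub_ne_zero.2 hne
      set s := (B l u ^ 2 - B u u + 1) / (2 * (B l u - B m u)) with hs
      have := reverse_cauchy_schwarz hB hφ (l := l) (by rw [hl]; norm_num) (u + s • (l - m))
      simp only [map_add, map_smul, map_sub, LinearMap.add_apply, LinearMap.smul_apply,
        LinearMap.sub_apply, smul_eq_mul, hl, hm, hml, ← ht, ← h1, hB u l, hB u m] at this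
      have h2 : s * (2 * (B l u - B m u)) = B l u ^ 2 - B u u + 1 := by
        rw [hs]; field_simp
      nlinarith
    have key := triple_product_le (x := fun i => B l (v i)) (y := fun i => B l (v i)) (κ := 2)
      (p11 := 2 * B (v 0) (v 0)) (p22 := 2 * B (v 1) (v 1)) (p33 := 2 * B (v 2) (v 2))
      (p12 := 2 * B (v 0) (v 1)) (p13 := 2 * B (v 0) (v 2)) (p23 := 2 * B (v 1) (v 2))
      (by norm_num) hlv hlv (by linarith [hv 0 0]) (by linarith [hv 1 1]) (by linarith [hv 2 2])
      (by linarith [hv 0 2]) (by linarith [hv 1 2]) (by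
        intro a b c
        have := reverse_cauchy_schwarz hB hφ (l := l) (by rw [hl]; norm_num)
          (a • v 0 + b • v 1 + c • v 2)
        rw [comb, hl] at this
        simp only [map_add, map_smul, smul_eq_mul] at this
        nlinarith)
    simp only [← hab, ← h1, Fin.prod_univ_three] at key ⊢
    nlinarith
  · set D := Real.sqrt (t ^ 2 - 1) with hD
    have hD2 : D ^ 2 = t ^ 2 - 1 := Real.sq_sqrt (by nlinarith)
    have hDpos : 0 < D := Real.sqrt_pos.2 (by nlinarith)
    -- The larger root of `ρ ^ 2 - 2 * t * ρ + 1`; the null coordinates of `u` are `ρ * B m u - B l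
    -- u` and `ρ * B l u - B m u`.
    set ρ := t + D with hρ
    have hρ1 : 1 < ρ := by linarith
    have hρ2 : ρ ^ 2 = 2 * t * ρ - 1 := by rw [hρ]; nlinarith
    have bound : ∀ u, 2 * ρ * D ^ 2 * B u u ≤
        2 * (ρ * B m u - B l u) * (ρ * B l u - B m u) := by
      intro u
      -- This vector is `D ^ 2` times the component of `u` orthogonal to `l` and `m`.
      have hw := reverse_cauchy_schwarz hB hφ (l := l) (by rw [hl]; norm_num)
        (D ^ 2 • u - (t * B m u - B l u) • l - (t * B l u - B m u) • m)
      simp only [map_sub, map_smul, smul_eq_mul, LinearMap.sub_apply, LinearMap.smul_apply, hl, hm,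
        hml, ← ht, hB u l, hB u m] at hw
      have h0 : D ^ 2 * B l u - (t * B m u - B l u) * 1 - (t * B l u - B m u) * t = 0 := by
        rw [hD2]; ring
      rw [h0] at hw
      have h3 : D ^ 2 * (D ^ 2 * B u u - (2 * t * B l u * B m u - B l u ^ 2 - B m u ^ 2)) ≤ 0 := by
        refine le_of_eq_of_le ?_ (hw.trans_eq (by ring))
        rw [hD2]; ring
      have h4 : D ^ 2 * B u u ≤ 2 * t * B l u * B m u - B l u ^ 2 - B m u ^ 2 := by
        by_contra! hlt
        have : 0 < D ^ 2 * (D ^ 2 * B u u - (2 * t * B l u * B m u - B l u ^ 2 - B m u ^ 2)) :=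
          mul_pos (by positivity) (by linarith)
        linarith
      have e5 : 2 * (ρ * B m u - B l u) * (ρ * B l u - B m u) =
          2 * ρ * (2 * t * B l u * B m u - B l u ^ 2 - B m u ^ 2) := by
        linear_combination 2 * (B l u * B m u) * hρ2
      rw [e5, mul_assoc]
      exact mul_le_mul_of_nonneg_left h4 (by linarith)
    -- The two coordinates have nonnegative product and nonnegative sum.
    have nonneg : ∀ i, 0 ≤ ρ * B m (v i) - B l (v i) ∧ 0 ≤ ρ * B l (v i) - B m (v i) := by
      intro i
      have h1 : 0 ≤ (ρ * B m (v i) - B l (v i)) * (ρ * B l (v i) - B m (v i)) := by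
        have h2 : 0 ≤ 2 * ρ * D ^ 2 * B (v i) (v i) := mul_nonneg (by positivity) (hv i i)
        linarith [bound (v i)]
      have ha := hlv i
      have hb := hmv i
      have h2 : 0 ≤ (ρ - 1) * B m (v i) := mul_nonneg (by linarith) hb
      have h3 : 0 ≤ (ρ - 1) * B l (v i) := mul_nonneg (by linarith) ha
      constructor <;> by_contra! hneg <;> nlinarith
    have hc : 0 ≤ 2 * ρ * D ^ 2 := by positivity
    have key := triple_product_le (x := fun i => ρ * B m (v i) - B l (v i))
      (y := fun i => ρ * B l (v i) - B m (v i)) (κ := 2 * t)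
      (p12 := 2 * ρ * D ^ 2 * B (v 0) (v 1))
      (by linarith) (fun i => (nonneg i).1) (fun i => (nonneg i).2)
      (mul_nonneg hc (hv 0 0)) (mul_nonneg hc (hv 1 1)) (mul_nonneg hc (hv 2 2))
      (mul_nonneg hc (hv 0 2)) (mul_nonneg hc (hv 1 2)) (by
        intro a b c
        have := bound (a • v 0 + b • v 1 + c • v 2)
        rw [comb] at this
        simp only [map_add, map_smul, smul_eq_mul] at this
        linarith)
    -- With `κ = 2 * t` the quadratic in the null coordinates becomes a multiple of `B l (v i) * B m
    -- (v i)`.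
    have fac : ∀ i, (ρ * B m (v i) - B l (v i)) ^ 2
        + 2 * t * ((ρ * B m (v i) - B l (v i)) * (ρ * B l (v i) - B m (v i)))
        + (ρ * B l (v i) - B m (v i)) ^ 2 = 4 * ρ * D ^ 2 * (B l (v i) * B m (v i)) := by
      intro i
      rw [hD2]
      linear_combination (2 * t * B l (v i) * B m (v i) + B l (v i) ^ 2 + B m (v i) ^ 2) * hρ2
    simp only [fac, Fin.prod_univ_three] at key ⊢
    have h8 : 0 < 8 * (ρ * D ^ 2) ^ 3 := by positivity
    refine le_of_mul_le_mul_left ?_ h8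
    nlinarith

/-! ### Lorentzian matrices and their quadratic forms. -/

open Matrix in
theorem quadraticForm_eq_sum_eigenvalues {n : ℕ} {p : Matrix (Fin n) (Fin n) ℝ}
    (hp : p.IsHermitian) (u : Fin n → ℝ) :
    u ⬝ᵥ p *ᵥ u =
      ∑ i, hp.eigenvalues i * ((hp.eigenvectorUnitary : Matrix (Fin n) (Fin n) ℝ)ᵀ *ᵥ u) i ^ 2 := by
  set U : Matrix (Fin n) (Fin n) ℝ := hp.eigenvectorUnitary.1 with hU
  have h : p = U * diagonal hp.eigenvalues * Uᵀ := by
    conv_lhs => rw [hp.spectral_theorem, Unitary.conjStarAlgAut_apply]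
    rfl
  conv_lhs => rw [h]
  rw [← mulVec_mulVec, ← mulVec_mulVec, dotProduct_mulVec, ← mulVec_transpose]
  simp only [dotProduct, mulVec_diagonal]
  exact Finset.sum_congr rfl fun i _ => by ring

/-- The quadratic form of a Lorentzian matrix is nonpositive on a hyperplane. -/
theorem IsLorentzian.exists_form_nonpos {n : ℕ} {p : Matrix (Fin n) (Fin n) ℝ}
    (hp : IsLorentzian p) :
    ∃ φ : (Fin n → ℝ) →ₗ[ℝ] ℝ, ∀ x, φ x = 0 → Matrix.toLinearMap₂' ℝ p x x ≤ 0 := by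
  have hh := hp.isHermitian
  by_cases hpos : ∃ i, 0 < hh.eigenvalues i
  · obtain ⟨i, hi⟩ := hpos
    refine ⟨LinearMap.proj i ∘ₗ
      Matrix.mulVecLin (hh.eigenvectorUnitary : Matrix (Fin n) (Fin n) ℝ).transpose, ?_⟩
    intro x hx
    rw [Matrix.toLinearMap₂'_apply', quadraticForm_eq_sum_eigenvalues hh]
    refine Finset.sum_nonpos fun j _ => ?_
    rcases eq_or_ne j i with rfl | hj
    · have h0 : ((hh.eigenvectorUnitary : Matrix (Fin n) (Fin n) ℝ).transpose.mulVec x) j = 0 := hx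
      simp [h0]
    · refine mul_nonpos_of_nonpos_of_nonneg (not_lt.1 fun hlt => hj ?_) (sq_nonneg _)
      exact Finset.card_le_one.1 hp.card_pos_eigenvalues_le_one j (by simpa using hlt) i
        (by simpa using hi)
  · push Not at hpos
    refine ⟨0, fun x _ => ?_⟩
    rw [Matrix.toLinearMap₂'_apply', quadraticForm_eq_sum_eigenvalues hh]
    exact Finset.sum_nonpos fun j _ => mul_nonpos_of_nonpos_of_nonneg (hpos j) (sq_nonneg _)

/-- Two eigenvectors with positive eigenvalues would span a plane on which the form is positive
definite, and that plane meets the kernel of `φ`. -/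
theorem isLorentzian_of_form_nonpos {n : ℕ} {p : Matrix (Fin n) (Fin n) ℝ}
    (hs : ∀ i j, p i j = p j i) (hnn : ∀ i j, 0 ≤ p i j) (φ : (Fin n → ℝ) →ₗ[ℝ] ℝ)
    (hφ : ∀ x, φ x = 0 → ∑ i, ∑ j, x i * x j * p i j ≤ 0) : IsLorentzian p := by
  have hh : p.IsHermitian := Matrix.IsHermitian.ext fun i j => by simp [hs i j]
  refine ⟨hh, hnn, Finset.card_le_one.2 fun i hi j hj => ?_⟩
  simp only [Finset.mem_filter, Finset.mem_univ, true_and] at hi hj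
  by_contra hij
  set e : Fin n → Fin n → ℝ := fun k => ⇑(hh.eigenvectorBasis k) with he
  have eig : ∀ k, p.mulVec (e k) = hh.eigenvalues k • e k := hh.mulVec_eigenvectorBasis
  have orth : ∀ k l, e k ⬝ᵥ e l = if k = l then 1 else 0 := by
    intro k l
    have h1 := orthonormal_iff_ite.1 hh.eigenvectorBasis.orthonormal l k
    rw [PiLp.inner_apply] at h1
    simp only [RCLike.inner_apply, conj_trivial] at h1
    rw [dotProduct]
    simpa [he, eq_comm] using h1
  have form : ∀ s t : ℝ, ∑ k, ∑ l, (s • e i + t • e j) k * (s • e i + t • e j) l * p k l =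
      s ^ 2 * hh.eigenvalues i + t ^ 2 * hh.eigenvalues j := by
    intro s t
    have h1 := Matrix.toLinearMap₂'_apply (S₁ := ℝ) (S₂ := ℝ) (R := ℝ) p (s • e i + t • e j)
      (s • e i + t • e j)
    rw [Matrix.toLinearMap₂'_apply'] at h1
    simp only [smul_eq_mul, ← mul_assoc] at h1
    rw [← h1, Matrix.mulVec_add, Matrix.mulVec_smul, Matrix.mulVec_smul, eig, eig]
    simp [orth, hij, Ne.symm hij]
    ring
  have h1 := hφ (φ (e j) • e i + (-φ (e i)) • e j) (by simp; ring)
  rw [form] at h1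
  have h2 : φ (e i) = 0 := by
    by_contra hne
    have : 0 < (-φ (e i)) ^ 2 * hh.eigenvalues j :=
      mul_pos (by rw [neg_sq]; positivity) hj
    have := mul_nonneg (sq_nonneg (φ (e j))) hi.le
    linarith
  have h3 := hφ ((1 : ℝ) • e i + (0 : ℝ) • e j) (by simp [h2])
  rw [form] at h3
  linarith

theorem IsLorentzian.symm {n : ℕ} {p : Matrix (Fin n) (Fin n) ℝ} (hp : IsLorentzian p)
    (i j : Fin n) : p i j = p j i := by
  simpa using hp.isHermitian.apply j i

theorem pentagonal_inequality {n : ℕ} {p : Matrix (Fin n) (Fin n) ℝ} (hp : IsLorentzian p)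
    (i j k l m : Fin n) :
    p i j * p i k * p j k * p l l * p l m * p m m
      ≤ 4 * (p i l * p j l * p k l * p i m * p j m * p k m) := by
  have hrhs : 0 ≤ 4 * (p i l * p j l * p k l * p i m * p j m * p k m) := by
    have := fun a b c d e f => mul_nonneg (mul_nonneg (mul_nonneg (mul_nonneg (mul_nonneg
      (hp.nonneg i a) (hp.nonneg j b)) (hp.nonneg k c)) (hp.nonneg i d)) (hp.nonneg j e))
      (hp.nonneg k f)
    exact mul_nonneg (by norm_num) (this _ _ _ _ _ _)
  rcases (hp.nonneg l l).eq_or_lt with hl | hl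
  · simpa [← hl] using hrhs
  rcases (hp.nonneg m m).eq_or_lt with hm | hm
  · simpa [← hm] using hrhs
  obtain ⟨φ, hφ⟩ := hp.exists_form_nonpos
  set B : (Fin n → ℝ) →ₗ[ℝ] (Fin n → ℝ) →ₗ[ℝ] ℝ :=
    Matrix.toLinearMap₂' ℝ p with hBdef
  have hBs : ∀ a b, B (Pi.single a 1) (Pi.single b 1) = p a b := fun a b => by
    simp [hBdef, Matrix.toLinearMap₂'_apply, Pi.single_apply]
  have hB : ∀ x y, B x y = B y x := by
    intro x y
    simp only [hBdef, Matrix.toLinearMap₂'_apply]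
    rw [Finset.sum_comm]
    refine Finset.sum_congr rfl fun a _ => Finset.sum_congr rfl fun b _ => ?_
    simp only [smul_eq_mul, hp.symm b a]; ring
  set s := Real.sqrt (p l l) with hs
  set t := Real.sqrt (p m m) with ht
  have hs0 : 0 < s := Real.sqrt_pos.2 hl
  have ht0 : 0 < t := Real.sqrt_pos.2 hm
  have hs2 : p l l = s ^ 2 := (Real.sq_sqrt hl.le).symm
  have ht2 : p m m = t ^ 2 := (Real.sq_sqrt hm.le).symm
  have key := pentagonal_inequality_of_normalized hB hφ
    (v := ![Pi.single i 1, Pi.single j 1, Pi.single k 1])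
    (l := s⁻¹ • Pi.single l 1) (m := t⁻¹ • Pi.single m 1)
    (by simp only [map_smul, LinearMap.smul_apply, hBs, hs2, smul_eq_mul]; field_simp)
    (by simp only [map_smul, LinearMap.smul_apply, hBs, ht2, smul_eq_mul]; field_simp)
    (by
      simp only [map_smul, LinearMap.smul_apply, hBs, smul_eq_mul]
      have := hp.nonneg l m
      positivity)
    (by
      intro a b
      fin_cases a <;> fin_cases b <;> simpa [hBs] using hp.nonneg _ _)
    (by
      intro a
      fin_cases a <;> simp [hBs] <;> exact mul_nonneg (by positivity) (hp.nonneg _ _))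
    (by
      intro a
      fin_cases a <;> simp [hBs] <;> exact mul_nonneg (by positivity) (hp.nonneg _ _))
  simp only [Fin.prod_univ_three, Matrix.cons_val_zero, Matrix.cons_val_one, Matrix.cons_val,
    map_smul, LinearMap.smul_apply, hBs, smul_eq_mul] at key
  rw [hs2, ht2]
  have h6 := mul_le_mul_of_nonneg_left key (show 0 ≤ s ^ 3 * t ^ 3 by positivity)
  rw [hp.symm i l, hp.symm j l, hp.symm k l, hp.symm i m, hp.symm j m, hp.symm k m]
  refine le_of_eq_of_le ?_ (h6.trans_eq ?_) <;> field_simp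

/-! ### Monomials as functions of the exponent. -/

theorem ratioMonomial_add {n : ℕ} {p : Matrix (Fin n) (Fin n) ℝ} (hp : ∀ i j, 0 < p i j)
    (α β : UpperPair n → ℝ) :
    ratioMonomial (α + β) p = ratioMonomial α p * ratioMonomial β p := by
  simp only [ratioMonomial, ← Finset.prod_mul_distrib, Pi.add_apply]
  exact Finset.prod_congr rfl fun q _ => Real.rpow_add (hp _ _) _ _

theorem ratioMonomial_sub {n : ℕ} {p : Matrix (Fin n) (Fin n) ℝ} (hp : ∀ i j, 0 < p i j)
    (α β : UpperPair n → ℝ) :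
    ratioMonomial (α - β) p = ratioMonomial α p / ratioMonomial β p := by
  simp only [ratioMonomial, ← Finset.prod_div_distrib, Pi.sub_apply]
  exact Finset.prod_congr rfl fun q _ => Real.rpow_sub (hp _ _) _ _

theorem ratioMonomial_smul {n : ℕ} {p : Matrix (Fin n) (Fin n) ℝ} (hp : ∀ i j, 0 < p i j)
    (c : ℝ) (α : UpperPair n → ℝ) : ratioMonomial (c • α) p = ratioMonomial α p ^ c := by
  simp only [ratioMonomial, Pi.smul_apply, smul_eq_mul]
  rw [← Real.finsetProd_rpow _ _ fun q _ => Real.rpow_nonneg (hp _ _).le _]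
  exact Finset.prod_congr rfl fun q _ => by rw [mul_comm, Real.rpow_mul (hp _ _).le]

theorem ratioMonomial_basisVec {n : ℕ} {p : Matrix (Fin n) (Fin n) ℝ} (hp : ∀ i j, p i j = p j i)
    (i j : Fin n) : ratioMonomial (basisVec i j) p = p i j := by
  rw [ratioMonomial, Finset.prod_eq_single (⟨(min i j, max i j), min_le_max⟩ : UpperPair n)]
  · simp only [basisVec, Pi.single_eq_same, Real.rpow_one]
    rcases le_total i j with h | h <;> simp [h, hp j i]
  · intro q _ hq
    simp [basisVec, Pi.single_eq_of_ne hq]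
  · simp

theorem ratioMonomial_pentagonalRatio {n : ℕ} {p : Matrix (Fin n) (Fin n) ℝ}
    (hp : p ∈ lorentzianPos n) (i j k l m : Fin n) :
    ratioMonomial (pentagonalRatio i j k l m) p =
      (p i j * p i k * p j k * p l l * p l m * p m m) /
        (p i l * p j l * p k l * p i m * p j m * p k m) := by
  simp only [pentagonalRatio, ratioMonomial_sub hp.2, ratioMonomial_add hp.2,
    ratioMonomial_basisVec hp.1.symm, div_div]

theorem ratioMonomial_pentagonalRatio_le {n : ℕ} {p : Matrix (Fin n) (Fin n) ℝ}
    (hp : p ∈ lorentzianPos n) (i j k l m : Fin n) :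
    ratioMonomial (pentagonalRatio i j k l m) p ≤ 4 := by
  rw [ratioMonomial_pentagonalRatio hp, div_le_iff₀]
  · exact pentagonal_inequality hp.1 i j k l m
  · have := fun a b c d e f => mul_pos (mul_pos (mul_pos (mul_pos (mul_pos
      (hp.2 i a) (hp.2 j b)) (hp.2 k c)) (hp.2 i d)) (hp.2 j e)) (hp.2 k f)
    exact this _ _ _ _ _ _

/-! ### Optimality of the constant 4. -/

/-- A positive vector gives a Lorentzian matrix of points in the hyperbolic plane on a line. -/
theorem hyperbolicLine_mem_lorentzianPos {n : ℕ} {u : Fin n → ℝ} (hu : ∀ i, 0 < u i) :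
    (Matrix.of fun i j => u i / u j + u j / u i) ∈ lorentzianPos n := by
  have hpos : ∀ i j, 0 < u i / u j + u j / u i := fun i j =>
    add_pos (div_pos (hu i) (hu j)) (div_pos (hu j) (hu i))
  refine ⟨isLorentzian_of_form_nonpos (fun i j => by simp [add_comm]) (fun i j => (hpos i j).le)
    (∑ i, u i • LinearMap.proj i) ?_, hpos⟩
  intro x hx
  simp only [LinearMap.sum_apply, LinearMap.smul_apply, LinearMap.proj_apply, smul_eq_mul] at hx
  have : ∑ i, ∑ j, x i * x j * (u i / u j + u j / u i) =
      2 * (∑ i, u i * x i) * ∑ j, x j / u j := by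
    have e1 : ∑ i, ∑ j, x i * x j * (u i / u j) = (∑ i, u i * x i) * ∑ j, x j / u j := by
      rw [Finset.sum_mul_sum]
      exact Finset.sum_congr rfl fun i _ => Finset.sum_congr rfl fun j _ => by ring
    have e2 : ∑ i, ∑ j, x i * x j * (u j / u i) = (∑ i, u i * x i) * ∑ j, x j / u j := by
      rw [Finset.sum_comm, ← e1]
      exact Finset.sum_congr rfl fun i _ => Finset.sum_congr rfl fun j _ => by ring
    simp only [mul_add, Finset.sum_add_distrib, e1, e2]
    ring
  simp [this, hx]

/-- Lorentzian matrices whose pentagonal ratio is arbitrarily close to `4`. -/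
theorem exists_hyperbolicLine_ratio {n : ℕ} {i j k l m : Fin n} (h : [i, j, k, l, m].Nodup)
    {s : ℝ} (hs : 0 < s) :
    ∃ p ∈ lorentzianPos n,
      (p i j * p i k * p j k * p l l * p l m * p m m) /
        (p i l * p j l * p k l * p i m * p j m * p k m) =
      4 * ((1 + s ^ 4) ^ 3 * (1 + s ^ 8)) / ((1 + s ^ 2) ^ 4 * (1 + s ^ 6) ^ 2) := by
  simp only [List.nodup_cons, List.mem_cons, List.not_mem_nil, not_or, or_false] at h
  obtain ⟨⟨hij, hik, hil, him⟩, ⟨hjk, hjl, hjm⟩, ⟨hkl, hkm⟩, hlm, -⟩ := h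
  -- In units of `log s` the points sit at 0, 2, -2 for `i`, `j`, `k` and at 1, -1 for `l`, `m`. The
  -- distances in numerator and denominator both sum to 10, so as `s → 0` only the diagonal entries
  -- `2 * 2` survive.
  set u : Fin n → ℝ := fun a => if a = j then s ^ 2 else if a = k then (s ^ 2)⁻¹
    else if a = l then s else if a = m then s⁻¹ else 1 with hu
  have hupos : ∀ a, 0 < u a := by
    intro a
    simp only [hu]
    split_ifs <;> positivity
  refine ⟨_, hyperbolicLine_mem_lorentzianPos hupos, ?_⟩
  have ui : u i = 1 := by simp [hu, hij, hik, hil, him]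
  have uj : u j = s ^ 2 := by simp [hu]
  have uk : u k = (s ^ 2)⁻¹ := by simp [hu, Ne.symm hjk]
  have ul : u l = s := by simp [hu, Ne.symm hjl, Ne.symm hkl]
  have um : u m = s⁻¹ := by simp [hu, Ne.symm hjm, Ne.symm hkm, Ne.symm hlm]
  simp only [Matrix.of_apply, ui, uj, uk, ul, um]
  field_simp
  ring

theorem four_le_of_forall_ratio_le {c : ℝ}
    (h : ∀ s : ℝ, 0 < s →
      4 * ((1 + s ^ 4) ^ 3 * (1 + s ^ 8)) / ((1 + s ^ 2) ^ 4 * (1 + s ^ 6) ^ 2) ≤ c) :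
    4 ≤ c := by
  have hc : Continuous fun s : ℝ =>
      4 * ((1 + s ^ 4) ^ 3 * (1 + s ^ 8)) / ((1 + s ^ 2) ^ 4 * (1 + s ^ 6) ^ 2) :=
    Continuous.div (by fun_prop) (by fun_prop) fun s => by positivity
  have ht := (hc.tendsto 0).mono_left (nhdsWithin_le_nhds (s := Set.Ioi 0))
  norm_num at ht
  exact le_of_tendsto ht (eventually_nhdsWithin_of_forall fun s hs => h s hs)

theorem pentagonal_constant_optimal {n : ℕ} {i j k l m : Fin n} (h : [i, j, k, l, m].Nodup) :
    (∀ c : ℝ, (∀ p ∈ lorentzian n,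
        p i j * p i k * p j k * p l l * p l m * p m m
          ≤ c * (p i l * p j l * p k l * p i m * p j m * p k m)) → 4 ≤ c) ∧
    pentagonalRatio i j k l m ∈ boundedRatios (lorentzianPos n) ∧
    optimalBoundingConstant (lorentzianPos n) (pentagonalRatio i j k l m) = 4 := by
  have bound : ∀ p ∈ lorentzianPos n, ratioMonomial (pentagonalRatio i j k l m) p ≤ 4 :=
    fun p hp => ratioMonomial_pentagonalRatio_le hp i j k l m
  refine ⟨fun c hc => four_le_of_forall_ratio_le fun s hs => ?_, ⟨4, by norm_num, bound⟩,
    IsLeast.csInf_eq ⟨⟨by norm_num, bound⟩, ?_⟩⟩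
  · obtain ⟨p, hp, hps⟩ := exists_hyperbolicLine_ratio h hs
    rw [← hps, div_le_iff₀]
    · exact hc p hp.1
    · exact mul_pos (mul_pos (mul_pos (mul_pos (mul_pos
        (hp.2 _ _) (hp.2 _ _)) (hp.2 _ _)) (hp.2 _ _)) (hp.2 _ _)) (hp.2 _ _)
  · rintro c ⟨-, hc⟩
    refine four_le_of_forall_ratio_le fun s hs => ?_
    obtain ⟨p, hp, hps⟩ := exists_hyperbolicLine_ratio h hs
    rw [← hps, ← ratioMonomial_pentagonalRatio hp]
    exact hc p hp

/-! ### The linear program on five points. -/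

set_option maxHeartbeats 4000000 in
/-- The linear programming step for five points `u, v, x, y, z`, with all distances as variables:
if `x`, `y` and `z` are blocked, then the weight of the cut `{u, v}` is nonnegative. -/
theorem cutWeight_nonneg_of_distances {uv ux uy uz vx vy vz xy xz yz : ℝ}
    (h0 : uv + xy + xz + yz ≤ ux + uy + uz + vx + vy + vz)
    (h1 : vx ≤ uv + ux)
    (h2 : vy ≤ uv + uy)
    (h3 : vz ≤ uv + uz)
    (h4 : xy ≤ ux + uy)
    (h5 : xz ≤ ux + uz)
    (h6 : yz ≤ uy + uz)
    (h7 : ux ≤ uv + vx)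
    (h8 : uy ≤ uv + vy)
    (h9 : uz ≤ uv + vz)
    (h10 : xy ≤ vx + vy)
    (h11 : xz ≤ vx + vz)
    (h12 : yz ≤ vy + vz)
    (h13 : uv ≤ ux + vx)
    (h14 : uv ≤ uy + vy)
    (h15 : uv ≤ uz + vz)
    (hx : uv = ux + vx ∨
      uy = ux + xy ∨
      uz = ux + xz ∨
      vy = vx + xy ∨
      vz = vx + xz ∨
      yz = xy + xz ∨
      ux + vy + vz + yz = uv + uy + uz + vx + xy + xz ∨
      vx + uy + uz + yz = uv + vy + vz + ux + xy + xz ∨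
      xy + uv + uz + vz = ux + vx + xz + uy + vy + yz ∨
      xz + uv + uy + vy = ux + vx + xy + uz + vz + yz)
    (hy : uv = uy + vy ∨
      ux = uy + xy ∨
      uz = uy + yz ∨
      vx = vy + xy ∨
      vz = vy + yz ∨
      xz = xy + yz ∨
      uy + vx + vz + xz = uv + ux + uz + vy + xy + yz ∨
      vy + ux + uz + xz = uv + vx + vz + uy + xy + yz ∨
      xy + uv + uz + vz = ux + vx + xz + uy + vy + yz ∨
      yz + uv + ux + vx = uy + vy + xy + uz + vz + xz)
    (hz : uv = uz + vz ∨
      ux = uz + xz ∨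
      uy = uz + yz ∨
      vx = vz + xz ∨
      vy = vz + yz ∨
      xy = xz + yz ∨
      uz + vx + vy + xy = uv + ux + uy + vz + xz + yz ∨
      vz + ux + uy + xy = uv + vx + vy + uz + xz + yz ∨
      xz + uv + uy + vy = ux + vx + xy + uz + vz + yz ∨
      yz + uv + ux + vx = uy + vy + xy + uz + vz + xz) :
    2 * (xy + xz + yz) ≤ uv + ux + uy + uz + vx + vy + vz := by
  -- Each point has six triangle and four pentagonal equalities that can block it, which gives a
  -- thousand linear programs.
  rcases hx with hx | hx | hx | hx | hx | hx | hx | hx | hx | hx <;> rcases hy with hy | hy | hy | hy | hy | hy | hy | hy | hy | hy <;> rcases hz with hz | hz | hz | hz | hz | hz | hz | hz | hz | hz <;> linarith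

/-! ### Farkas' lemma. -/

/-- Farkas' lemma for finitely generated cones. -/
theorem mem_hull_range_or_exists_separating {E : Type*} [AddCommGroup E] [Module ℝ E] :
    ∀ (n : ℕ) (v : Fin n → E) (b : E), b ∈ PointedCone.hull ℝ (Set.range v) ∨
      ∃ f : E →ₗ[ℝ] ℝ, (∀ i, f (v i) ≤ 0) ∧ 0 < f b
  | 0, v, b => by
    rcases eq_or_ne b 0 with rfl | hb
    · exact Or.inl (zero_mem _)
    · right
      obtain ⟨f, hf⟩ : ∃ f : Module.Dual ℝ E, f b ≠ 0 := by
        by_contra! h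
        exact hb ((Module.forall_dual_apply_eq_zero_iff ℝ b).1 h)
      rcases hf.lt_or_gt with h | h
      · exact ⟨-f, fun i => i.elim0, by simpa using h⟩
      · exact ⟨f, fun i => i.elim0, h⟩
  | n + 1, v, b => by
    have hsub : PointedCone.hull ℝ (Set.range (Fin.tail v)) ≤
        PointedCone.hull ℝ (Set.range v) :=
      Submodule.span_mono (Set.range_comp_subset_range Fin.succ v)
    have h0 : v 0 ∈ PointedCone.hull ℝ (Set.range v) :=
      PointedCone.subset_hull ⟨0, rfl⟩
    rcases mem_hull_range_or_exists_separating n (Fin.tail v) b with h | ⟨f, hf, hfb⟩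
    · exact Or.inl (hsub h)
    rcases le_or_gt (f (v 0)) 0 with hf0 | hf0
    · exact Or.inr ⟨f, fun i => Fin.cases hf0 hf i, hfb⟩
    -- The projection onto the kernel of `f` along `v 0`. It moves the other generators by
    -- nonnegative multiples of `v 0` and `b` by a negative one.
    set π : E →ₗ[ℝ] E := LinearMap.id - (f.smulRight ((f (v 0))⁻¹ • v 0)) with hπ
    have hπx : ∀ x, π x = x - (f x / f (v 0)) • v 0 := fun x => by
      simp [hπ, smul_smul, div_eq_mul_inv]
    rcases mem_hull_range_or_exists_separating n (π ∘ Fin.tail v) (π b) with h | ⟨g, hg, hgb⟩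
    · left
      have hle : PointedCone.hull ℝ (Set.range (π ∘ Fin.tail v)) ≤
          PointedCone.hull ℝ (Set.range v) := by
        refine Submodule.span_le.2 ?_
        rintro _ ⟨i, rfl⟩
        have : (π ∘ Fin.tail v) i = Fin.tail v i + (-f (Fin.tail v i) / f (v 0)) • v 0 := by
          rw [Function.comp_apply, hπx, neg_div, neg_smul, sub_eq_add_neg]
        rw [this]
        exact add_mem (hsub (PointedCone.subset_hull ⟨i, rfl⟩))
          (PointedCone.smul_mem _ (div_nonneg (by linarith [hf i]) hf0.le) h0)
      have := add_mem (hle h) (PointedCone.smul_mem _ (div_nonneg hfb.le hf0.le) h0)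
      rwa [hπx, sub_add_cancel] at this
    · refine Or.inr ⟨g ∘ₗ π, fun i => Fin.cases ?_ hg i, hgb⟩
      simp [hπx, div_self hf0.ne']

/-! ### Pentagonal metrics on five points are sums of cuts. -/

/-- The cut semimetric of a set of points. -/
noncomputable def cutMetric {n : ℕ} (S : Finset (Fin n)) (i j : Fin n) : ℝ :=
  if (i ∈ S ↔ j ∈ S) then 0 else 1

/-- The slack of the pentagonal inequality at the pair `l, m`, for a semimetric on five points. -/
noncomputable def pentagonalSlack (d : Fin 5 → Fin 5 → ℝ) (l m : Fin 5) : ℝ :=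
  2 * ∑ a, d l a + 2 * ∑ a, d m a - 4 * d l m - (∑ a, ∑ b, d a b) / 2

/-- A semimetric on five points that satisfies the pentagonal inequalities. -/
structure IsPentagonalMetric (d : Fin 5 → Fin 5 → ℝ) : Prop where
  symm : ∀ a b, d a b = d b a
  self : ∀ a, d a a = 0
  triangle : ∀ a b c, a ≠ b → a ≠ c → b ≠ c → d b c ≤ d a b + d a c
  pentagonal : ∀ l m, l ≠ m → 0 ≤ pentagonalSlack d l m

/-- No positive multiple of the cut `{a}` can be subtracted from `d`. -/
def IsBlocked (d : Fin 5 → Fin 5 → ℝ) (a : Fin 5) : Prop :=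
  (∃ b c, a ≠ b ∧ a ≠ c ∧ b ≠ c ∧ d b c = d a b + d a c) ∨
    ∃ m, a ≠ m ∧ pentagonalSlack d a m = 0

/-- The coefficient of the cut `{c, e}` in a combination of cuts by two-element sets. -/
noncomputable def cutWeight (d : Fin 5 → Fin 5 → ℝ) (c e : Fin 5) : ℝ :=
  (∑ a, d c a + ∑ a, d e a - d c e) / 2 - (∑ a, ∑ b, d a b) / 6

theorem cutMetric_singleton_triangle {a x b c : Fin 5} (hb : x ≠ b) (hc : x ≠ c) (hbc : b ≠ c) :
    cutMetric {a} x b + cutMetric {a} x c - cutMetric {a} b c = if x = a then 2 else 0 := by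
  simp only [cutMetric, Finset.mem_singleton]
  split_ifs <;> grind

theorem pentagonalSlack_cutMetric_singleton {a l m : Fin 5} (h : l ≠ m) :
    pentagonalSlack (cutMetric {a}) l m = if l = a ∨ m = a then 2 else 0 := by
  have row : ∀ x, ∑ b, cutMetric {a} x b = if x = a then 4 else 1 := by
    intro x
    fin_cases a <;> fin_cases x <;> simp [cutMetric, Fin.sum_univ_five] <;> norm_num
  have total : ∑ x, ∑ b, cutMetric {a} x b = 8 := by
    simp only [row, Finset.sum_ite, Finset.sum_const, nsmul_eq_mul, Finset.filter_eq',
      Finset.filter_ne', Finset.mem_univ, if_true, Finset.card_singleton,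
      Finset.card_erase_of_mem, Finset.card_univ, Fintype.card_fin]
    norm_num
  rw [pentagonalSlack, total, row, row]
  simp only [cutMetric, Finset.mem_singleton]
  by_cases h1 : l = a <;> by_cases h2 : m = a
  · exact absurd (h1.trans h2.symm) h
  all_goals simp [h1, h2]; try norm_num

theorem pentagonalSlack_sub_smul (d e : Fin 5 → Fin 5 → ℝ) (t : ℝ) (l m : Fin 5) :
    pentagonalSlack (d - t • e) l m = pentagonalSlack d l m - t * pentagonalSlack e l m := by
  simp only [pentagonalSlack, Pi.sub_apply, Pi.smul_apply, smul_eq_mul, Finset.sum_sub_distrib,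
    ← Finset.mul_sum]
  ring

/-- Subtracting `t` times the cut `{a}` lowers every slack at `a` by `2 * t` and leaves the others
alone, so `t` is half the smallest slack at `a`. -/
theorem IsPentagonalMetric.exists_isBlocked_sub {d : Fin 5 → Fin 5 → ℝ}
    (hd : IsPentagonalMetric d) (a : Fin 5) :
    ∃ t : ℝ, 0 ≤ t ∧ IsPentagonalMetric (d - t • cutMetric {a}) ∧
      IsBlocked (d - t • cutMetric {a}) a := by
  let ι := {q : Fin 5 × Fin 5 // a ≠ q.1 ∧ a ≠ q.2 ∧ q.1 ≠ q.2} ⊕ {m : Fin 5 // a ≠ m}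
  let A : ι → ℝ := Sum.elim (fun q => d a q.1.1 + d a q.1.2 - d q.1.1 q.1.2)
    fun m => pentagonalSlack d a m
  have hA : ∀ i, 0 ≤ A i := by
    rintro (⟨q, h1, h2, h3⟩ | ⟨m, hm⟩)
    · exact sub_nonneg.2 (hd.triangle _ _ _ h1 h2 h3)
    · exact hd.pentagonal _ _ hm
  obtain ⟨m, hm⟩ : ∃ m, a ≠ m := ⟨a + 1, by fin_cases a <;> decide⟩
  have : Nonempty ι := ⟨Sum.inr ⟨m, hm⟩⟩
  obtain ⟨i, hi⟩ := Finite.exists_min A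
  have tri : ∀ x b c, x ≠ b → x ≠ c → b ≠ c →
      (d - (A i / 2) • cutMetric {a}) x b + (d - (A i / 2) • cutMetric {a}) x c
        - (d - (A i / 2) • cutMetric {a}) b c =
      d x b + d x c - d b c - if x = a then A i else 0 := by
    intro x b c h1 h2 h3
    have := cutMetric_singleton_triangle (a := a) h1 h2 h3
    simp only [Pi.sub_apply, Pi.smul_apply, smul_eq_mul]
    split_ifs at this ⊢ <;> linear_combination (-(A i / 2)) * this
  have pent : ∀ l m, l ≠ m → pentagonalSlack (d - (A i / 2) • cutMetric {a}) l m =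
      pentagonalSlack d l m - if l = a ∨ m = a then A i else 0 := by
    intro l m h
    rw [pentagonalSlack_sub_smul, pentagonalSlack_cutMetric_singleton h]
    split_ifs <;> ring
  have slack_comm : ∀ l m, pentagonalSlack d l m = pentagonalSlack d m l := by
    intro l m
    rw [pentagonalSlack, pentagonalSlack, hd.symm l m]; ring
  refine ⟨A i / 2, by linarith [hA i], ⟨?_, ?_, ?_, ?_⟩, ?_⟩
  · intro x y
    simp [cutMetric, hd.symm x y, iff_comm]
  · intro x
    simp [cutMetric, hd.self]
  · intro x b c h1 h2 h3
    rw [← sub_nonneg, tri x b c h1 h2 h3]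
    split_ifs with h
    · subst h
      exact sub_nonneg.2 (hi (Sum.inl ⟨(b, c), h1, h2, h3⟩))
    · linarith [hd.triangle x b c h1 h2 h3]
  · intro l m h
    rw [pent l m h]
    split_ifs with h'
    · rcases h' with rfl | rfl
      · exact sub_nonneg.2 (hi (Sum.inr ⟨m, h⟩))
      · rw [slack_comm]
        exact sub_nonneg.2 (hi (Sum.inr ⟨l, h.symm⟩))
    · linarith [hd.pentagonal l m h]
  · rcases hAi : i with ⟨q, h1, h2, h3⟩ | ⟨m, hm⟩
    · refine Or.inl ⟨q.1, q.2, h1, h2, h3, ?_⟩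
      have h4 := tri a q.1 q.2 h1 h2 h3
      have h5 : A i = d a q.1 + d a q.2 - d q.1 q.2 := by rw [hAi]; rfl
      rw [if_pos rfl, h5, sub_self] at h4
      rw [← hAi, h5]
      linarith
    · refine Or.inr ⟨m, hm, ?_⟩
      have h5 : A i = pentagonalSlack d a m := by rw [hAi]; rfl
      rw [← hAi, pent a m hm, if_pos (Or.inl rfl), h5, sub_self]

/-- Subtracting a singleton cut never raises a slack, so a slack that vanishes stays zero as long as
the result is a pentagonal metric. Hence points can be blocked one after another. -/
theorem IsBlocked.sub_smul {d : Fin 5 → Fin 5 → ℝ} {a b : Fin 5} {t : ℝ} (ht : 0 ≤ t)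
    (hd : IsPentagonalMetric (d - t • cutMetric {b})) (h : IsBlocked d a) :
    IsBlocked (d - t • cutMetric {b}) a := by
  rcases h with ⟨x, y, h1, h2, h3, h4⟩ | ⟨m, hm, h4⟩
  · refine Or.inl ⟨x, y, h1, h2, h3, (hd.triangle a x y h1 h2 h3).antisymm ?_⟩
    have h5 := cutMetric_singleton_triangle (a := b) h1 h2 h3
    have h6 : 0 ≤ t * (if a = b then (2 : ℝ) else 0) :=
      mul_nonneg ht (by split_ifs <;> norm_num)
    rw [← h5] at h6
    simp only [Pi.sub_apply, Pi.smul_apply, smul_eq_mul]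
    linarith
  · refine Or.inr ⟨m, hm, le_antisymm ?_ (hd.pentagonal a m hm)⟩
    rw [pentagonalSlack_sub_smul, h4, pentagonalSlack_cutMetric_singleton hm]
    have h6 : 0 ≤ t * (if a = b ∨ m = b then (2 : ℝ) else 0) :=
      mul_nonneg ht (by split_ifs <;> norm_num)
    linarith

theorem IsPentagonalMetric.exists_forall_isBlocked {d : Fin 5 → Fin 5 → ℝ}
    (hd : IsPentagonalMetric d) (s : Finset (Fin 5)) :
    ∃ e, IsPentagonalMetric e ∧ (∀ a ∈ s, IsBlocked e a) ∧
      d - e ∈ PointedCone.hull ℝ (Set.range (cutMetric (n := 5))) := by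
  induction s using Finset.induction_on with
  | empty => exact ⟨d, hd, by simp, by rw [sub_self]; exact zero_mem _⟩
  | insert a s _ ih =>
    obtain ⟨e, he, hs, hde⟩ := ih
    obtain ⟨t, ht, h1, h2⟩ := he.exists_isBlocked_sub a
    refine ⟨_, h1, ?_, ?_⟩
    · intro b hb
      rcases Finset.mem_insert.1 hb with rfl | hb
      · exact h2
      · exact (hs b hb).sub_smul ht h1
    · rw [sub_sub_eq_add_sub, add_sub_right_comm]
      exact add_mem hde (PointedCone.smul_mem _ ht (PointedCone.subset_hull ⟨_, rfl⟩))

theorem pentagonalSlack_comp_perm (d : Fin 5 → Fin 5 → ℝ) (σ : Equiv.Perm (Fin 5))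
    (l m : Fin 5) :
    pentagonalSlack (fun a b => d (σ a) (σ b)) l m = pentagonalSlack d (σ l) (σ m) := by
  simp only [pentagonalSlack]
  rw [Equiv.sum_comp σ (fun a => d (σ l) a), Equiv.sum_comp σ (fun a => d (σ m) a),
      Equiv.sum_comp σ (fun a => ∑ b, d a (σ b)),
      Finset.sum_congr rfl fun a _ => Equiv.sum_comp σ (fun b => d a b)]

theorem IsPentagonalMetric.comp_perm {d : Fin 5 → Fin 5 → ℝ} (hd : IsPentagonalMetric d)
    (σ : Equiv.Perm (Fin 5)) : IsPentagonalMetric fun a b => d (σ a) (σ b) where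
  symm _ _ := hd.symm _ _
  self _ := hd.self _
  triangle _ _ _ h1 h2 h3 := hd.triangle _ _ _ (σ.injective.ne h1) (σ.injective.ne h2)
    (σ.injective.ne h3)
  pentagonal l m h := by
    rw [pentagonalSlack_comp_perm]
    exact hd.pentagonal _ _ (σ.injective.ne h)

theorem cutWeight_comp_perm (d : Fin 5 → Fin 5 → ℝ) (σ : Equiv.Perm (Fin 5)) (c e : Fin 5) :
    cutWeight (fun a b => d (σ a) (σ b)) c e = cutWeight d (σ c) (σ e) := by
  simp only [cutWeight]
  rw [Equiv.sum_comp σ (fun a => d (σ c) a), Equiv.sum_comp σ (fun a => d (σ e) a),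
      Equiv.sum_comp σ (fun a => ∑ b, d a (σ b)),
      Finset.sum_congr rfl fun a _ => Equiv.sum_comp σ (fun b => d a b)]

theorem IsBlocked.comp_perm {d : Fin 5 → Fin 5 → ℝ} {σ : Equiv.Perm (Fin 5)} {a : Fin 5}
    (h : IsBlocked d (σ a)) : IsBlocked (fun a b => d (σ a) (σ b)) a := by
  rcases h with ⟨x, y, h1, h2, h3, h4⟩ | ⟨m, hm, h4⟩
  · refine Or.inl ⟨σ.symm x, σ.symm y, ?_, ?_, σ.symm.injective.ne h3, by simpa using h4⟩
    · rintro rfl; simp at h1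
    · rintro rfl; simp at h2
  · refine Or.inr ⟨σ.symm m, ?_, ?_⟩
    · rintro rfl; simp at hm
    · rw [pentagonalSlack_comp_perm]; simpa using h4

theorem IsPentagonalMetric.cutWeight_zero_one_nonneg {d : Fin 5 → Fin 5 → ℝ}
    (hd : IsPentagonalMetric d) (hb : ∀ a, IsBlocked d a) : 0 ≤ cutWeight d 0 1 := by
  have s10 := hd.symm 1 0
  have s20 := hd.symm 2 0
  have s30 := hd.symm 3 0
  have s40 := hd.symm 4 0
  have s21 := hd.symm 2 1
  have s31 := hd.symm 3 1
  have s41 := hd.symm 4 1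
  have s32 := hd.symm 3 2
  have s42 := hd.symm 4 2
  have s43 := hd.symm 4 3
  have tri := hd.triangle
  have key := cutWeight_nonneg_of_distances (uv := d 0 1) (ux := d 0 2) (uy := d 0 3)
    (uz := d 0 4) (vx := d 1 2) (vy := d 1 3) (vz := d 1 4) (xy := d 2 3) (xz := d 2 4)
    (yz := d 3 4)
    (by
      have := hd.pentagonal 0 1 (by decide)
      simp only [pentagonalSlack, Fin.sum_univ_five, hd.self, s10, s20, s30, s40, s21, s31, s41,
        s32, s42, s43] at this
      linarith)
    (tri 0 1 2 (by decide) (by decide) (by decide))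
    (tri 0 1 3 (by decide) (by decide) (by decide))
    (tri 0 1 4 (by decide) (by decide) (by decide))
    (tri 0 2 3 (by decide) (by decide) (by decide))
    (tri 0 2 4 (by decide) (by decide) (by decide))
    (tri 0 3 4 (by decide) (by decide) (by decide))
    (s10 ▸ tri 1 0 2 (by decide) (by decide) (by decide))
    (s10 ▸ tri 1 0 3 (by decide) (by decide) (by decide))
    (s10 ▸ tri 1 0 4 (by decide) (by decide) (by decide))
    (tri 1 2 3 (by decide) (by decide) (by decide))
    (tri 1 2 4 (by decide) (by decide) (by decide))
    (tri 1 3 4 (by decide) (by decide) (by decide))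
    (s20 ▸ s21 ▸ tri 2 0 1 (by decide) (by decide) (by decide))
    (s30 ▸ s31 ▸ tri 3 0 1 (by decide) (by decide) (by decide))
    (s40 ▸ s41 ▸ tri 4 0 1 (by decide) (by decide) (by decide))
    (by
      rcases hb 2 with ⟨b, c, h1, h2, h3, h4⟩ | ⟨m, hm, h4⟩
      · fin_cases b <;> fin_cases c <;> simp [s10, s20, s30, s40, s21, s31, s41, s43] at h1 h2 h3 h4 <;>
          simp [h4, add_comm]
      · fin_cases m <;> simp only [pentagonalSlack, Fin.sum_univ_five, hd.self, Fin.zero_eta,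
          Fin.mk_one, Fin.reduceFinMk, s10, s20, s30, s40, s21, s31, s41, s32, s42,
          s43] at hm h4
        · iterate 6 right
          left; linarith
        · iterate 7 right
          left; linarith
        · exact absurd rfl hm
        · iterate 8 right
          left; linarith
        · iterate 9 right
          linarith)
    (by
      rcases hb 3 with ⟨b, c, h1, h2, h3, h4⟩ | ⟨m, hm, h4⟩
      · fin_cases b <;> fin_cases c <;> simp [s10, s20, s30, s40, s21, s31, s41, s32, s42] at h1 h2 h3 h4 <;>
          simp [h4, add_comm]
      · fin_cases m <;> simp only [pentagonalSlack, Fin.sum_univ_five, hd.self, Fin.zero_eta,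
          Fin.mk_one, Fin.reduceFinMk, s10, s20, s30, s40, s21, s31, s41, s32, s42,
          s43] at hm h4
        · iterate 6 right
          left; linarith
        · iterate 7 right
          left; linarith
        · iterate 8 right
          left; linarith
        · exact absurd rfl hm
        · iterate 9 right
          linarith)
    (by
      rcases hb 4 with ⟨b, c, h1, h2, h3, h4⟩ | ⟨m, hm, h4⟩
      · fin_cases b <;> fin_cases c <;> simp [s10, s20, s30, s40, s21, s31, s41, s32, s42,
          s43] at h1 h2 h3 h4 <;>
          simp [h4, add_comm]
      · fin_cases m <;> simp only [pentagonalSlack, Fin.sum_univ_five, hd.self, Fin.zero_eta,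
          Fin.mk_one, Fin.reduceFinMk, s10, s20, s30, s40, s21, s31, s41, s32, s42,
          s43] at hm h4
        · iterate 6 right
          left; linarith
        · iterate 7 right
          left; linarith
        · iterate 8 right
          left; linarith
        · iterate 9 right
          linarith
        · exact absurd rfl hm)
  simp only [cutWeight, Fin.sum_univ_five, hd.self, s10, s20, s30, s40, s21, s31, s41,
        s32, s42, s43]
  linarith

theorem exists_perm_zero_one {c e : Fin 5} (h : c ≠ e) :
    ∃ σ : Equiv.Perm (Fin 5), σ 0 = c ∧ σ 1 = e := by
  have hne : 0 ≠ Equiv.swap 0 c e := fun h0 => h (by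
    simpa using congrArg (Equiv.swap 0 c) h0)
  refine ⟨Equiv.swap 0 c * Equiv.swap 1 (Equiv.swap 0 c e), ?_, by simp⟩
  rw [Equiv.Perm.mul_apply, Equiv.swap_apply_of_ne_of_ne (by decide) hne, Equiv.swap_apply_left]

theorem IsPentagonalMetric.cutWeight_nonneg {d : Fin 5 → Fin 5 → ℝ}
    (hd : IsPentagonalMetric d) (hb : ∀ a, IsBlocked d a) {c e : Fin 5} (h : c ≠ e) :
    0 ≤ cutWeight d c e := by
  obtain ⟨σ, rfl, rfl⟩ := exists_perm_zero_one h
  rw [← cutWeight_comp_perm]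
  exact (hd.comp_perm σ).cutWeight_zero_one_nonneg fun a => (hb (σ a)).comp_perm

/-- The ten cuts by pairs form a basis of the symmetric functions with zero diagonal, and
`cutWeight` gives the coordinates. -/
theorem IsPentagonalMetric.eq_sum_cutMetric {d : Fin 5 → Fin 5 → ℝ}
    (hd : IsPentagonalMetric d) :
    d = ∑ q : Fin 5 × Fin 5 with q.1 < q.2, cutWeight d q.1 q.2 • cutMetric {q.1, q.2} := by
  have hf : (Finset.univ.filter fun q : Fin 5 × Fin 5 => q.1 < q.2) =
      {(0, 1), (0, 2), (0, 3), (0, 4), (1, 2), (1, 3), (1, 4), (2, 3), (2, 4), (3, 4)} := by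
    decide
  rw [hf]
  funext i j
  have s10 := hd.symm 1 0
  have s20 := hd.symm 2 0
  have s30 := hd.symm 3 0
  have s40 := hd.symm 4 0
  have s21 := hd.symm 2 1
  have s31 := hd.symm 3 1
  have s41 := hd.symm 4 1
  have s32 := hd.symm 3 2
  have s42 := hd.symm 4 2
  have s43 := hd.symm 4 3
  fin_cases i <;> fin_cases j <;>
    simp [cutMetric, cutWeight, Fin.sum_univ_five, hd.self, s10, s20, s30, s40, s21, s31, s41,
      s32, s42, s43] <;> ring

/-- A semimetric on five points that satisfies the pentagonal inequalities is a nonnegative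
combination of cut semimetrics. -/
theorem IsPentagonalMetric.mem_hull_cutMetric {d : Fin 5 → Fin 5 → ℝ}
    (hd : IsPentagonalMetric d) :
    d ∈ PointedCone.hull ℝ (Set.range (cutMetric (n := 5))) := by
  obtain ⟨e, he, hb, hde⟩ := hd.exists_forall_isBlocked Finset.univ
  rw [← sub_add_cancel d e]
  refine add_mem hde ?_
  rw [he.eq_sum_cutMetric]
  refine sum_mem fun q hq => PointedCone.smul_mem _ ?_ (PointedCone.subset_hull ⟨_, rfl⟩)
  exact he.cutWeight_nonneg (fun a => hb a (Finset.mem_univ a)) (Finset.mem_filter.1 hq).2.ne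

/-! ### Rays of Lorentzian matrices and the dual cone. -/

theorem ratioMonomial_exp {n : ℕ} (α : UpperPair n → ℝ) (Y : Fin n → Fin n → ℝ) :
    ratioMonomial α (Matrix.of fun i j => Real.exp (Y i j)) =
      Real.exp (∑ q, α q * Y q.1.1 q.1.2) := by
  rw [ratioMonomial, Real.exp_sum]
  exact Finset.prod_congr rfl fun q _ => by
    rw [Matrix.of_apply, ← Real.exp_mul, mul_comm]

/-- A bounded ratio pairs nonpositively with every ray of logarithms of matrices. -/
theorem sum_mul_nonpos_of_mem_boundedRatios {n : ℕ} {X : Set (Matrix (Fin n) (Fin n) ℝ)}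
    {α : UpperPair n → ℝ} (hα : α ∈ boundedRatios X) {Y : Fin n → Fin n → ℝ}
    (hY : ∀ T : ℝ, 0 ≤ T → (Matrix.of fun i j => Real.exp (T * Y i j)) ∈ X) :
    ∑ q, α q * Y q.1.1 q.1.2 ≤ 0 := by
  obtain ⟨c, hc, hb⟩ := hα
  by_contra! hpos
  set s := ∑ q, α q * Y q.1.1 q.1.2 with hs
  -- At this parameter the monomial equals `exp c`, which exceeds `c`.
  have h := hb _ (hY (c / s) (div_nonneg hc.le hpos.le))
  rw [ratioMonomial_exp α fun i j => c / s * Y i j] at h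
  have e : ∀ r : ℝ, ∑ q : UpperPair n, α q * (r * Y q.1.1 q.1.2) = r * s := fun r => by
    rw [hs, Finset.mul_sum]
    exact Finset.sum_congr rfl fun q _ => by ring
  rw [e, div_mul_cancel₀ c hpos.ne'] at h
  linarith [Real.add_one_le_exp c]

/-- With `A` and `B` the sums of `x` over `S` and its complement, the form is `A² + 2τAB + B² = (A +
τB)² - (τ² - 1)B²`. -/
theorem exp_cutMetric_mem_lorentzianPos {n : ℕ} (S : Finset (Fin n)) {T : ℝ} (hT : 0 ≤ T) :
    (Matrix.of fun i j => Real.exp (T * cutMetric S i j)) ∈ lorentzianPos n := by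
  set τ := Real.exp T with hτ
  have hτ1 : 1 ≤ τ := Real.one_le_exp hT
  set a : Fin n → ℝ := fun i => if i ∈ S then 1 else 0 with ha
  set b : Fin n → ℝ := fun i => if i ∈ S then 0 else 1 with hb
  have entry : ∀ i j, Real.exp (T * cutMetric S i j) =
      a i * a j + b i * b j + τ * (a i * b j + b i * a j) := by
    intro i j
    by_cases hi : i ∈ S <;> by_cases hj : j ∈ S <;> simp [cutMetric, ha, hb, hi, hj, hτ]
  refine ⟨isLorentzian_of_form_nonpos (fun i j => ?_) (fun i j => (Real.exp_pos _).le)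
    (∑ i, (a i + τ * b i) • LinearMap.proj i) ?_, fun i j => Real.exp_pos _⟩
  · simp [cutMetric, iff_comm]
  · intro x hx
    simp only [LinearMap.sum_apply, LinearMap.smul_apply, LinearMap.proj_apply, smul_eq_mul,
      add_mul, Finset.sum_add_distrib, mul_assoc, ← Finset.mul_sum] at hx
    have prod : ∀ u v : Fin n → ℝ, ∑ i, ∑ j, x i * x j * (u i * v j) =
        (∑ i, u i * x i) * ∑ j, v j * x j := by
      intro u v
      rw [Finset.sum_mul_sum]
      exact Finset.sum_congr rfl fun i _ => Finset.sum_congr rfl fun j _ => by ring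
    have e : ∑ i, ∑ j, x i * x j * (Matrix.of fun i j => Real.exp (T * cutMetric S i j)) i j =
        (∑ i, a i * x i) * (∑ i, a i * x i) + (∑ i, b i * x i) * (∑ i, b i * x i)
        + τ * ((∑ i, a i * x i) * (∑ i, b i * x i) + (∑ i, b i * x i) * (∑ i, a i * x i)) := by
      simp only [← prod, Matrix.of_apply, entry, Finset.mul_sum, ← Finset.sum_add_distrib]
      exact Finset.sum_congr rfl fun i _ => Finset.sum_congr rfl fun j _ => by ring
    rw [e]
    nlinarith [mul_nonneg (show 0 ≤ τ ^ 2 - 1 by nlinarith) (sq_nonneg (∑ i, b i * x i))]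

theorem exp_add_mem_lorentzianPos {n : ℕ} (g : Fin n → ℝ) (T : ℝ) :
    (Matrix.of fun i j => Real.exp (T * (g i + g j))) ∈ lorentzianPos n := by
  refine ⟨isLorentzian_of_form_nonpos (fun i j => by simp [add_comm])
    (fun i j => (Real.exp_pos _).le) (∑ i, Real.exp (T * g i) • LinearMap.proj i) ?_,
    fun i j => Real.exp_pos _⟩
  intro x hx
  simp only [LinearMap.sum_apply, LinearMap.smul_apply, LinearMap.proj_apply, smul_eq_mul] at hx
  have : ∑ i, ∑ j, x i * x j * (Matrix.of fun i j => Real.exp (T * (g i + g j))) i j =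
      (∑ i, Real.exp (T * g i) * x i) * ∑ j, Real.exp (T * g j) * x j := by
    rw [Finset.sum_mul_sum]
    refine Finset.sum_congr rfl fun i _ => Finset.sum_congr rfl fun j _ => ?_
    rw [Matrix.of_apply, mul_add, Real.exp_add]; ring
  rw [this, hx, zero_mul]

/-- The rank-one rays come in opposite pairs `g` and `-g`, so the pairing vanishes. -/
theorem sum_mul_add_eq_zero_of_mem_boundedRatios {n : ℕ} {α : UpperPair n → ℝ}
    (hα : α ∈ boundedRatios (lorentzianPos n)) (g : Fin n → ℝ) :
    ∑ q, α q * (g q.1.1 + g q.1.2) = 0 := by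
  have h1 := sum_mul_nonpos_of_mem_boundedRatios hα (Y := fun i j => g i + g j)
    fun T _ => exp_add_mem_lorentzianPos g T
  have h2 := sum_mul_nonpos_of_mem_boundedRatios hα (Y := fun i j => -g i + -g j)
    fun T _ => exp_add_mem_lorentzianPos (fun i => -g i) T
  refine h1.antisymm ?_
  rw [← neg_nonpos, ← Finset.sum_neg_distrib]
  refine le_of_eq_of_le (Finset.sum_congr rfl fun q _ => ?_) h2
  ring

theorem sum_mul_nonpos_of_mem_hull_cutMetric {n : ℕ} {α : UpperPair n → ℝ}
    (hα : α ∈ boundedRatios (lorentzianPos n)) {d : Fin n → Fin n → ℝ}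
    (hd : d ∈ PointedCone.hull ℝ (Set.range (cutMetric (n := n)))) :
    ∑ q, α q * d q.1.1 q.1.2 ≤ 0 := by
  induction hd using Submodule.span_induction with
  | mem x hx =>
    obtain ⟨S, rfl⟩ := hx
    exact sum_mul_nonpos_of_mem_boundedRatios hα fun T hT => exp_cutMetric_mem_lorentzianPos S hT
  | zero => simp
  | add x y _ _ hx hy =>
    simp only [Pi.add_apply, mul_add, Finset.sum_add_distrib]
    linarith
  | smul c x _ hx =>
    have : ∑ q : UpperPair n, α q * (c • x) q.1.1 q.1.2 =
        c.1 * ∑ q : UpperPair n, α q * x q.1.1 q.1.2 := by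
      rw [Finset.mul_sum]
      refine Finset.sum_congr rfl fun q _ => ?_
      rw [show (c • x) q.1.1 q.1.2 = c.1 * x q.1.1 q.1.2 from rfl]
      ring
    rw [this]
    exact mul_nonpos_of_nonneg_of_nonpos c.2 hx

theorem basisVec_comm {n : ℕ} (i j : Fin n) : basisVec i j = basisVec j i := by
  simp only [basisVec, min_comm i j, max_comm i j]

/-- A functional that is nonpositive on the pentagonal ratios defines a pentagonal metric. -/
theorem isPentagonalMetric_of_forall_pentagonalRatio_nonpos (f : (UpperPair 5 → ℝ) →ₗ[ℝ] ℝ)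
    (hf : ∀ i j k l m, f (pentagonalRatio i j k l m) ≤ 0) :
    IsPentagonalMetric fun a b =>
      2 * f (basisVec a b) - f (basisVec a a) - f (basisVec b b) where
  symm a b := by rw [basisVec_comm a b]; ring
  self a := by ring
  triangle a b c _ _ _ := by
    -- With these coincident indices the ratio collapses to `e_bc + e_aa - e_ab - e_ac`.
    have h := hf b b c b a
    simp only [pentagonalRatio, map_add, map_sub] at h
    rw [basisVec_comm b a, basisVec_comm c a, basisVec_comm c b] at h
    linarith
  pentagonal l m hlm := by
    obtain ⟨σ, rfl, rfl⟩ := exists_perm_zero_one hlm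
    -- The slack is `-2` times the value of `f` on this ratio.
    have h := hf (σ 2) (σ 3) (σ 4) (σ 0) (σ 1)
    rw [← pentagonalSlack_comp_perm]
    simp only [pentagonalSlack, Fin.sum_univ_five]
    simp only [pentagonalRatio, map_add, map_sub] at h
    rw [basisVec_comm (σ 1) (σ 0), basisVec_comm (σ 2) (σ 0), basisVec_comm (σ 3) (σ 0),
      basisVec_comm (σ 4) (σ 0), basisVec_comm (σ 2) (σ 1), basisVec_comm (σ 3) (σ 1),
      basisVec_comm (σ 4) (σ 1), basisVec_comm (σ 3) (σ 2), basisVec_comm (σ 4) (σ 2),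
      basisVec_comm (σ 4) (σ 3)]
    rw [basisVec_comm (σ 2) (σ 0), basisVec_comm (σ 3) (σ 0),
      basisVec_comm (σ 4) (σ 0), basisVec_comm (σ 2) (σ 1), basisVec_comm (σ 3) (σ 1),
      basisVec_comm (σ 4) (σ 1)] at h
    linarith

theorem apply_eq_sum_basisVec {n : ℕ} (f : (UpperPair n → ℝ) →ₗ[ℝ] ℝ) (α : UpperPair n → ℝ) :
    f α = ∑ q, α q * f (basisVec q.1.1 q.1.2) := by
  conv_lhs => rw [pi_eq_sum_univ' α]
  simp only [map_sum, map_smul, smul_eq_mul]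
  refine Finset.sum_congr rfl fun q _ => ?_
  congr 2
  obtain ⟨⟨i, j⟩, h⟩ := q
  simp [basisVec, min_eq_left h, max_eq_right h]

theorem boundedRatios_subset_hull :
    boundedRatios (lorentzianPos 5) ⊆
      (PointedCone.hull ℝ {α : UpperPair 5 → ℝ |
        ∃ i j k l m : Fin 5, α = pentagonalRatio i j k l m} : Set (UpperPair 5 → ℝ)) := by
  intro α hα
  let e := Fintype.equivFin (Fin 5 × Fin 5 × Fin 5 × Fin 5 × Fin 5)
  let v : Fin 5 × Fin 5 × Fin 5 × Fin 5 × Fin 5 → UpperPair 5 → ℝ :=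
    fun t => pentagonalRatio t.1 t.2.1 t.2.2.1 t.2.2.2.1 t.2.2.2.2
  rcases mem_hull_range_or_exists_separating _ (v ∘ e.symm) α with h | ⟨f, hf, hfα⟩
  · refine Submodule.span_mono ?_ h
    rintro _ ⟨t, rfl⟩
    exact ⟨_, _, _, _, _, rfl⟩
  · have hpent : ∀ i j k l m, f (pentagonalRatio i j k l m) ≤ 0 := fun i j k l m => by
      simpa [v] using hf (e (i, j, k, l, m))
    have h1 := sum_mul_nonpos_of_mem_hull_cutMetric hα
      (isPentagonalMetric_of_forall_pentagonalRatio_nonpos f hpent).mem_hull_cutMetric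
    have h2 := sum_mul_add_eq_zero_of_mem_boundedRatios hα fun a => f (basisVec a a)
    -- `2 * f` splits into the metric, which pairs nonpositively with `α`, and a term `g a + g b`,
    -- which pairs to zero; this contradicts `0 < f α`.
    have h3 : 2 * f α = ∑ q : UpperPair 5, α q * (2 * f (basisVec q.1.1 q.1.2)
          - f (basisVec q.1.1 q.1.1) - f (basisVec q.1.2 q.1.2))
        + ∑ q : UpperPair 5, α q * (f (basisVec q.1.1 q.1.1) + f (basisVec q.1.2 q.1.2)) := by
      rw [apply_eq_sum_basisVec f α, Finset.mul_sum, ← Finset.sum_add_distrib]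
      exact Finset.sum_congr rfl fun q _ => by ring
    linarith

theorem hull_subset_boundedRatios (n : ℕ) :
    (PointedCone.hull ℝ {α : UpperPair n → ℝ |
      ∃ i j k l m : Fin n, α = pentagonalRatio i j k l m} : Set (UpperPair n → ℝ)) ⊆
      boundedRatios (lorentzianPos n) := by
  intro α hα
  have nonneg : ∀ (β : UpperPair n → ℝ), ∀ p ∈ lorentzianPos n, 0 ≤ ratioMonomial β p :=
    fun β p hp => Finset.prod_nonneg fun q _ => Real.rpow_nonneg (hp.2 _ _).le _
  induction hα using Submodule.span_induction with
  | mem x hx =>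
    obtain ⟨i, j, k, l, m, rfl⟩ := hx
    exact ⟨4, by norm_num, fun p hp => ratioMonomial_pentagonalRatio_le hp i j k l m⟩
  | zero => exact ⟨1, one_pos, fun p _ => by simp [ratioMonomial]⟩
  | add x y _ _ hx hy =>
    obtain ⟨c, hc, hcx⟩ := hx
    obtain ⟨c', hc', hcy⟩ := hy
    refine ⟨c * c', mul_pos hc hc', fun p hp => ?_⟩
    rw [ratioMonomial_add hp.2]
    exact mul_le_mul (hcx p hp) (hcy p hp) (nonneg y p hp) hc.le
  | smul r x _ hx =>
    obtain ⟨c, hc, hcx⟩ := hx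
    refine ⟨c ^ r.1, Real.rpow_pos_of_pos hc _, fun p hp => ?_⟩
    rw [show r • x = r.1 • x from rfl, ratioMonomial_smul hp.2]
    exact Real.rpow_le_rpow (nonneg x p hp) (hcx p hp) r.2

theorem theoremA :
    -- the pentagonal inequality on Lorentzian matrices of any size, for any five indices
    (∀ (n : ℕ) (p : Matrix (Fin n) (Fin n) ℝ), p ∈ lorentzian n → ∀ i j k l m : Fin n,
      p i j * p i k * p j k * p l l * p l m * p m m
        ≤ 4 * (p i l * p j l * p k l * p i m * p j m * p k m)) ∧
    -- optimality of the constant `4` for five distinct indices, both in the inequality on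
    -- Lorentzian matrices and as the optimal bounding constant of the pentagonal ratio on
    -- Lorentzian matrices with positive entries
    (∀ (n : ℕ) (i j k l m : Fin n), [i, j, k, l, m].Nodup →
      (∀ c : ℝ, (∀ p ∈ lorentzian n,
          p i j * p i k * p j k * p l l * p l m * p m m
            ≤ c * (p i l * p j l * p k l * p i m * p j m * p k m)) → 4 ≤ c) ∧
      pentagonalRatio i j k l m ∈ boundedRatios (lorentzianPos n) ∧
      optimalBoundingConstant (lorentzianPos n) (pentagonalRatio i j k l m) = 4) ∧
    -- the cone of bounded ratios for `n = 5`
    boundedRatios (lorentzianPos 5) =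
      (PointedCone.hull ℝ {α : UpperPair 5 → ℝ |
        ∃ i j k l m : Fin 5, α = pentagonalRatio i j k l m} : Set (UpperPair 5 → ℝ)) := by
  exact ⟨fun n p hp i j k l m => pentagonal_inequality hp i j k l m,
    fun n i j k l m h => pentagonal_constant_optimal h,
    boundedRatios_subset_hull.antisymm (hull_subset_boundedRatios 5)⟩
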